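/- Let $C_n$ denote the cyclic group of order $n$, and let \[\Gamma=C_2^{*3}\times C_3=\langle a_1,a_2,a_3,b : a_i^2=[a_i,b]=b^3=1\rangle,\] where $C_2^{*3}=C_2*C_2*C_2$ is the free product, with the symmetric generating set $E=\{a_1,a_2,a_3,b,b^{-1}\}$. Let $G=\operatorname{Cay}(\Gamma,E)$ be the Cayley graph with vertex set $\Gamma$ and edges $(x,x\gamma)$ for $x\in\Gamma$, $\gamma\in E$. For a measurable space $A$, let $\Gamma$ act on $A^\Gamma$ by $(\gamma\cdot x)(\delta)=x(\gamma^{-1}\delta)$. Then $G$ admits a $\Gamma$-f.i.i.d. $3$-coloring. That is, there is a $\Gamma$-invariant Borel probability measure $\nu$ on $\{0,1,2\}^\Gamma$ such that 1. $\nu$-almost every $c\in\{0,1,2\}^\Gamma$ is a proper coloring of $G$, i.e. $c(x)\neq c(y)$ whenever $x$ and $y$ are adjacent in $G$; and 2. $\nu$ is a factor of the i.i.d. process $([0,1]^\Gamma,\lambda^\Gamma)$, where $\lambda$ is Lebesgue measure: there is a measurable map $F:[0,1]^\Gamma\to\{0,1,2\}^\Gamma$ with $F_*\lambda^\Gamma=\nu$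 and, for $\lambda^\Gamma$-almost every $x$, $F(\gamma\cdot x)=\gamma\cdot F(x)$ for all $\gamma\in\Gamma$. -/

import Mathlib

open MeasureTheory

noncomputable section

namespace FactorOfIID

/-! ### Labellings, the shift, factors of i.i.d. -/

section General

variable {Γ A B : Type*} [Group Γ]

/-- The left shift action of `Γ` on vertex labellings: `(g · x)(h) = x (g⁻¹ h)`. -/
def shift (g : Γ) (x : Γ → A) : Γ → A := fun h => x (g⁻¹ * h)

variable [MeasurableSpace A] [MeasurableSpace B]

/-- Invariance of a measure on `A ^ Γ` under the shift action of `Γ`. -/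
def IsShiftInvariant (ν : Measure (Γ → A)) : Prop :=
  ∀ g : Γ, ν.map (shift g) = ν

/-- `F` is a factor map from the shift system `(A ^ Γ, μ)` to the shift system `(B ^ Γ, ν)`:
it is measurable, pushes `μ` to `ν`, and commutes with the shift almost everywhere. -/
structure IsFactorMap (μ : Measure (Γ → A)) (ν : Measure (Γ → B))
    (F : (Γ → A) → (Γ → B)) : Prop where
  measurePreserving : MeasurePreserving F μ ν
  equivariant : ∀ᵐ x ∂μ, ∀ g : Γ, F (shift g x) = shift g (F x)

variable (Γ) in
/-- The law `λ ^ Γ` of i.i.d. uniform `[0,1]`-valued labels indexed by `Γ`. -/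
def iidUniform : Measure (Γ → unitInterval) :=
  Measure.infinitePi fun _ : Γ => (volume : Measure unitInterval)

/-- `ν` is a `Γ`-factor of i.i.d.: a shift-invariant measure which is a factor of
`([0,1] ^ Γ, λ ^ Γ)`. -/
def IsFIID (ν : Measure (Γ → A)) : Prop :=
  IsShiftInvariant ν ∧ ∃ F : (Γ → unitInterval) → (Γ → A), IsFactorMap (iidUniform Γ) ν F

end General

/-- `c` is a proper vertex colouring of `G` with `n` colours. -/
def IsProperColoring {V : Type*} (G : SimpleGraph V) {n : ℕ} (c : V → Fin n) : Prop :=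
  ∀ x y : V, G.Adj x y → c x ≠ c y

/-- `ν` is (the law of) a random proper `n`-colouring of `G`. -/
structure IsRandomColoring {V : Type*} (G : SimpleGraph V) {n : ℕ}
    (ν : Measure (V → Fin n)) : Prop where
  isProbabilityMeasure : IsProbabilityMeasure ν
  ae_proper : ∀ᵐ c ∂ν, IsProperColoring G c

/-- The Cayley graph of `Γ` with respect to `E` (edges `x — x γ`, `γ ∈ E`, viewed as an
undirected graph) admits a `Γ`-f.i.i.d. `n`-colouring. -/
def AdmitsFIIDColoring (Γ : Type*) [Group Γ] (E : Set Γ) (n : ℕ) : Prop :=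
  ∃ ν : Measure (Γ → Fin n), IsRandomColoring (SimpleGraph.mulCayley E) ν ∧ IsFIID ν

/-! ### The group `C₂ * C₂ * C₂ × C₃` -/

/-- The free product `C₂ * C₂ * C₂`. -/
abbrev C2FreeCube : Type := Monoid.CoprodI fun _ : Fin 3 => Multiplicative (ZMod 2)

/-- `Γ = (C₂ * C₂ * C₂) × C₃`. -/
abbrev Gam : Type := C2FreeCube × Multiplicative (ZMod 3)

/-- The generator of the `i`-th factor `C₂`. -/
def genA (i : Fin 3) : Gam :=
  (Monoid.CoprodI.of (M := fun _ : Fin 3 => Multiplicative (ZMod 2)) (i := i)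
    (Multiplicative.ofAdd 1), 1)

/-- The generator of the factor `C₃`. -/
def genB : Gam := (1, Multiplicative.ofAdd 1)

/-- The generating set `{a₁, a₂, a₃, b}`, made symmetric by adding `b⁻¹`. -/
def gens : Set Gam := {genA 0, genA 1, genA 2, genB, genB⁻¹}

end FactorOfIID

end

/-! It suffices to find, equivariantly and almost surely, an independent set meeting each triangle
`{x, xb, xb⁻¹}` in exactly one point. Colouring a vertex by its position relative to that point is
then proper: equal colours at `x` and `x aᵢ` would make the chosen points of their two triangles
adjacent.

The set is built greedily along keys in a well-founded order on `ℕ × ℕ × ℕ`, with distinct keys at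
adjacent vertices. If it missed a triangle, each of the three vertices would be blocked by a chosen
neighbour with smaller key, and in three different directions `aᵢ`, since a neighbouring triangle
contains at most one chosen point. So it is enough that from every triangle the keys increase in
some direction: this leaves only two directions for three blockers (`exists_inTransversal`).

Such keys come from a flow along the `aᵢ`. The `n`-th hubs have density `O(4⁻ⁿ)`
(`measure_hub_triMin_le`), yet by exponential growth every vertex is within `8n` of one. Each `n`-th
hub sends a path of length `O(n)` to the next hubs. By mass transport a vertex lies on such a path
with probability `O(n 4⁻ⁿ)`, so by Borel–Cantelli on paths of finitely many levels only
(`ae_bddAbove_onPath`). Following the path of highest level raises the pair (level, height)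
lexicographically (`exists_lex_lt`). Feeding in the minimal label of each triangle makes this pair
constant on triangles. -/

noncomputable section

namespace FactorOfIID

/-! ### Greedy independent sets along a well-founded order -/

section Greedy

variable {Γ α : Type*} [Group Γ] (E : Set Γ) (r : α → α → Prop)

/-- `x` is selected after `k` rounds of the greedy algorithm which runs through the Cayley graph
with generators `E` in the order given by the keys `κ`: each neighbour of `x` with smaller key
has itself a neighbour with smaller key that was selected in fewer rounds. -/
def selectedBy (κ : Γ → α) : ℕ → Γ → Prop
  | 0, _ => False
  | k + 1, x => ∀ s ∈ E, r (κ (x * s)) (κ x) →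
      ∃ t ∈ E, r (κ (x * s * t)) (κ (x * s)) ∧ selectedBy κ k (x * s * t)

/-- The set of vertices selected by the greedy algorithm. -/
def Selected (κ : Γ → α) (x : Γ) : Prop := ∃ k, selectedBy E r κ k x

variable {E r} {κ : Γ → α}

lemma selectedBy_succ {k : ℕ} {x : Γ} (h : selectedBy E r κ k x) :
    selectedBy E r κ (k + 1) x := by
  induction k generalizing x with
  | zero => exact h.elim
  | succ k ih =>
    intro s hs hr
    obtain ⟨t, ht, hr', h'⟩ := h s hs hr
    exact ⟨t, ht, hr', ih h'⟩

lemma selectedBy_mono {k l : ℕ} (hkl : k ≤ l) {x : Γ} (h : selectedBy E r κ k x) :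
    selectedBy E r κ l x := by
  induction hkl with
  | refl => exact h
  | step _ ih => exact selectedBy_succ ih

/-- No well-foundedness is needed: selection of `x` yields a selected smaller neighbour of `x * s`,
so the same conflict recurs with a smaller total number of rounds. -/
lemma not_selectedBy_of_selectedBy {k m : ℕ} {x s : Γ} (hs : s ∈ E)
    (hr : r (κ (x * s)) (κ x)) (hx : selectedBy E r κ k x) :
    ¬ selectedBy E r κ m (x * s) := by
  induction hn : k + m using Nat.strong_induction_on generalizing k m x s with
  | _ n ih =>
    intro hm
    cases k with
    | zero => exact hx
    | succ k =>
      obtain ⟨t, ht, hr', h'⟩ := hx s hs hr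
      exact ih (m + k) (by omega) ht hr' hm rfl h'

lemma selected_or (hE : E.Finite) (hr : WellFounded r) (x : Γ) :
    Selected E r κ x ∨ ∃ s ∈ E, r (κ (x * s)) (κ x) ∧ Selected E r κ (x * s) := by
  induction hx : κ x using hr.induction generalizing x with
  | _ a ih =>
    subst hx
    by_contra! h
    obtain ⟨h1, h2⟩ := h
    have key : ∀ s : E, ∃ k, r (κ (x * s)) (κ x) →
        ∃ t ∈ E, r (κ (x * s * t)) (κ (x * s)) ∧ selectedBy E r κ k (x * s * t) := by
      rintro ⟨s, hs⟩
      by_cases hr' : r (κ (x * s)) (κ x)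
      · rcases ih _ hr' (x * s) rfl with h | ⟨t, ht, hrt, k, hk⟩
        · exact absurd h (h2 s hs hr')
        · exact ⟨k, fun _ => ⟨t, ht, hrt, hk⟩⟩
      · exact ⟨0, fun h => absurd h hr'⟩
    choose k hk using key
    have := hE.to_subtype
    -- As `E` is finite, one number of rounds serves all smaller neighbours of `x`.
    obtain ⟨K, hK⟩ := (Set.finite_range k).bddAbove
    refine h1 ⟨K + 1, fun s hs hr' => ?_⟩
    obtain ⟨t, ht, hrt, h⟩ := hk ⟨s, hs⟩ hr'
    exact ⟨t, ht, hrt, selectedBy_mono (hK ⟨_, rfl⟩) h⟩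

lemma not_selected_of_selected {x s : Γ} (hs : s ∈ E)
    (hr : r (κ (x * s)) (κ x)) (hx : Selected E r κ x) : ¬ Selected E r κ (x * s) := by
  rintro ⟨m, hm⟩
  obtain ⟨k, hk⟩ := hx
  exact not_selectedBy_of_selectedBy hs hr hk hm

lemma selectedBy_shift (g : Γ) (k : ℕ) (x : Γ) :
    selectedBy E r (shift g κ) k x ↔ selectedBy E r κ k (g⁻¹ * x) := by
  induction k generalizing x with
  | zero => exact Iff.rfl
  | succ k ih => simp only [selectedBy, ih, shift, mul_assoc]

lemma selected_shift (g : Γ) (x : Γ) :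
    Selected E r (shift g κ) x ↔ Selected E r κ (g⁻¹ * x) :=
  exists_congr fun k => selectedBy_shift g k x

lemma measurable_selected [Countable Γ] [Countable α] [MeasurableSpace α]
    [MeasurableSingletonClass α] {Ω : Type*} [MeasurableSpace Ω] {κ : Ω → Γ → α}
    (hκ : ∀ x, Measurable fun ω => κ ω x) (x : Γ) :
    Measurable fun ω => Selected E r (κ ω) x := by
  have hr : ∀ x y, Measurable fun ω => r (κ ω x) (κ ω y) := fun x y =>
    (Measurable.of_discrete (f := fun p : α × α => r p.1 p.2)).comp ((hκ x).prodMk (hκ y))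
  refine Measurable.exists fun k => ?_
  induction k generalizing x with
  | zero => exact measurable_const
  | succ k ih =>
    refine Measurable.forall fun s => measurable_const.imp ((hr _ _).imp ?_)
    exact Measurable.exists fun t => measurable_const.and ((hr _ _).and (ih _))

end Greedy

/-! ### Measurability of infima and suprema in `ℕ` -/

section Nat

variable {Ω : Type*} [MeasurableSpace Ω]

lemma measurable_sInf_nat {P : Ω → ℕ → Prop} (hP : ∀ n, Measurable fun ω => P ω n) :
    Measurable fun ω => sInf {n | P ω n} := by
  have key : ∀ m, Measurable fun ω => sInf {n | P ω n} ≤ m := fun m => by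
    -- The second alternative accounts for `sInf ∅ = 0`.
    have : (fun ω => sInf {n | P ω n} ≤ m) = fun ω => (∃ n ≤ m, P ω n) ∨ ∀ n, ¬ P ω n := by
      funext ω
      refine propext ⟨fun h => ?_, fun h => ?_⟩
      · by_cases hne : ∃ n, P ω n
        · exact Or.inl ⟨_, h, Nat.sInf_mem hne⟩
        · exact Or.inr (not_exists.1 hne)
      · rcases h with ⟨n, hn, h⟩ | h
        · exact (Nat.sInf_le h).trans hn
        · simp [h]
    rw [this]
    exact (Measurable.exists fun n => measurable_const.and (hP n)).or
      (Measurable.forall fun n => (hP n).not)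
  exact measurable_of_Iic fun m => measurableSet_setOfPred.2 (key m)

lemma measurable_sSup_nat {P : Ω → ℕ → Prop} (hP : ∀ n, Measurable fun ω => P ω n) :
    Measurable fun ω => sSup {n | P ω n} := by
  -- The supremum is the least upper bound; for an unbounded set both sides take the default value
  -- `0`.
  have : (fun ω => sSup {n | P ω n}) = fun ω => sInf {m | ∀ n, P ω n → n ≤ m} := by
    funext ω
    classical
    by_cases h : ∃ m, ∀ n ∈ {n | P ω n}, n ≤ m
    · rw [Nat.sSup_def h, ← Nat.sInf_def (s := {m | ∀ n ∈ {n | P ω n}, n ≤ m}) h]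
      rfl
    · have h1 : sSup {n | P ω n} = 0 := Nat.sSup_of_not_bddAbove fun ⟨m, hm⟩ => h ⟨m, hm⟩
      have h2 : {m | ∀ n, P ω n → n ≤ m} = ∅ :=
        Set.eq_empty_iff_forall_notMem.2 fun m hm => h ⟨m, hm⟩
      rw [h1, h2, Nat.sInf_empty]
  rw [this]
  exact measurable_sInf_nat fun m => Measurable.forall fun n => (hP n).imp measurable_const

end Nat

/-! ### Hubs and the flow between them -/

section Flow

variable {Γ : Type*} [Group Γ] {ι : Type*} (a : ι → Γ)

/-- `x` is at distance at most `k` from `P` in the Cayley graph with generators `a i`. -/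
def near (P : Γ → Prop) : ℕ → Γ → Prop
  | 0, x => P x
  | k + 1, x => near P k x ∨ ∃ i, near P k (x * a i)

/-- The label at `x` is less than `4⁻ⁿ`. -/
def low (n : ℕ) (ω : Γ → unitInterval) (x : Γ) : Prop := (ω x : ℝ) < (1 / 4) ^ n

/-- The `n`-th hubs: the points with label less than `4⁻ⁿ`, and the points without such a point
at distance at most `8 n`. -/
def hub (n : ℕ) (ω : Γ → unitInterval) (x : Γ) : Prop :=
  low n ω x ∨ ¬ near a (low n ω) (8 * n) x

/-- The distance to the set of `(n + 1)`-st hubs. -/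
def hubDist (n : ℕ) (ω : Γ → unitInterval) (x : Γ) : ℕ := sInf {k | near a (hub a (n + 1) ω) k x}

variable {a}

lemma near_of_imp {P Q : Γ → Prop} (h : ∀ x, P x → Q x) {k : ℕ} {x : Γ}
    (hx : near a P k x) : near a Q k x := by
  induction k generalizing x with
  | zero => exact h x hx
  | succ k ih => exact hx.imp ih fun ⟨i, hi⟩ => ⟨i, ih hi⟩

lemma near_of_self {P : Γ → Prop} {k : ℕ} {x : Γ} (hx : P x) : near a P k x := by
  induction k with
  | zero => exact hx
  | succ k ih => exact Or.inl ih

lemma near_hub (n : ℕ) (ω : Γ → unitInterval) (x : Γ) : near a (hub a n ω) (8 * n) x := by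
  by_cases h : near a (low n ω) (8 * n) x
  · exact near_of_imp (fun _ => Or.inl) h
  · exact near_of_self (Or.inr h)

lemma near_hubDist (n : ℕ) (ω : Γ → unitInterval) (x : Γ) :
    near a (hub a (n + 1) ω) (hubDist a n ω x) x :=
  Nat.sInf_mem (s := {k | near a (hub a (n + 1) ω) k x}) ⟨8 * (n + 1), near_hub (n + 1) ω x⟩

lemma hubDist_le (n : ℕ) (ω : Γ → unitInterval) (x : Γ) : hubDist a n ω x ≤ 8 * (n + 1) :=
  Nat.sInf_le (near_hub (n + 1) ω x)

lemma near_shift (P : Γ → Prop) (g : Γ) (k : ℕ) (x : Γ) :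
    near a (shift g P) k x ↔ near a P k (g⁻¹ * x) := by
  induction k generalizing x with
  | zero => exact Iff.rfl
  | succ k ih => simp only [near, ih, mul_assoc]

lemma hub_shift (n : ℕ) (ω : Γ → unitInterval) (g x : Γ) :
    hub a n (shift g ω) x ↔ hub a n ω (g⁻¹ * x) :=
  or_congr Iff.rfl (not_congr (near_shift (low n ω) g _ x))

lemma hubDist_shift (n : ℕ) (ω : Γ → unitInterval) (g x : Γ) :
    hubDist a n (shift g ω) x = hubDist a n ω (g⁻¹ * x) := by
  have : hub a (n + 1) (shift g ω) = shift g (hub a (n + 1) ω) :=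
    funext fun x => propext (hub_shift _ ω g x)
  simp only [hubDist, this, near_shift]

lemma measurable_near {Ω : Type*} [MeasurableSpace Ω] [Countable ι] {P : Ω → Γ → Prop}
    (hP : ∀ x, Measurable fun ω => P ω x)
    (k : ℕ) (x : Γ) : Measurable fun ω => near a (P ω) k x := by
  induction k generalizing x with
  | zero => exact hP x
  | succ k ih => exact (ih x).or (Measurable.exists fun i => ih _)

omit [Group Γ] in
lemma measurable_low (n : ℕ) (x : Γ) : Measurable fun ω : Γ → unitInterval => low n ω x :=
  measurableSet_setOfPred.1 <|
    measurableSet_lt (measurable_subtype_coe.comp (measurable_pi_apply x)) measurable_const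

lemma measurable_hub [Countable ι] (n : ℕ) (x : Γ) :
    Measurable fun ω : Γ → unitInterval => hub a n ω x :=
  (measurable_low n x).or (measurable_near (measurable_low n) _ x).not

lemma measurable_hubDist [Countable ι] (n : ℕ) (x : Γ) :
    Measurable fun ω : Γ → unitInterval => hubDist a n ω x :=
  measurable_sInf_nat fun k => measurable_near (measurable_hub (n + 1)) k x

variable [LinearOrder ι] (a)

/-- `i` is the first direction in which the distance to the `(n + 1)`-st hubs decreases. -/
def Descends (n : ℕ) (ω : Γ → unitInterval) (x : Γ) (i : ι) : Prop :=
  hubDist a n ω (x * a i) < hubDist a n ω x ∧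
    ∀ j < i, ¬ hubDist a n ω (x * a j) < hubDist a n ω x

/-- `x` is the `j`-th vertex on the descending path from some `n`-th hub to the `(n + 1)`-st
hubs. -/
def flow (n : ℕ) (ω : Γ → unitInterval) : ℕ → Γ → Prop
  | 0, x => hub a n ω x
  | j + 1, x => ∃ i, Descends a n ω (x * a i) i ∧ flow n ω j (x * a i)

/-- `x` lies on the descending path from some `n`-th hub to the `(n + 1)`-st hubs. -/
def OnPath (n : ℕ) (ω : Γ → unitInterval) (x : Γ) : Prop := ∃ j, flow a n ω j x

/-- The largest `n` such that `x` lies on a path from an `n`-th hub. -/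
def level (ω : Γ → unitInterval) (x : Γ) : ℕ := sSup {n | OnPath a n ω x}

/-- The progress of `x` towards the hubs it is directed to. -/
def height (ω : Γ → unitInterval) (x : Γ) : ℕ :=
  8 * (level a ω x + 1) - hubDist a (level a ω x) ω x

variable {a}

lemma exists_descends [Finite ι] {n : ℕ} {ω : Γ → unitInterval} {x : Γ}
    (hx : ¬ hub a (n + 1) ω x) : ∃ i, Descends a n ω x i := by
  have key : ∃ i, hubDist a n ω (x * a i) < hubDist a n ω x := by
    have h := near_hubDist (a := a) n ω x
    obtain h0 | ⟨k, hk⟩ : hubDist a n ω x = 0 ∨ ∃ k, hubDist a n ω x = k + 1 := by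
      cases hubDist a n ω x <;> simp
    · rw [h0] at h
      exact absurd h hx
    · rw [hk] at h ⊢
      rcases h with h | ⟨i, hi⟩
      · have : hubDist a n ω x ≤ k := Nat.sInf_le h
        omega
      · exact ⟨i, Nat.lt_succ_of_le (Nat.sInf_le hi)⟩
  obtain ⟨i, hi, hmin⟩ := (wellFounded_lt (α := ι)).has_min
    {i | hubDist a n ω (x * a i) < hubDist a n ω x} key
  exact ⟨i, hi, fun j hj h => hmin j h hj⟩

lemma Descends.unique {n : ℕ} {ω : Γ → unitInterval} {x : Γ} {i j : ι}
    (hi : Descends a n ω x i) (hj : Descends a n ω x j) : i = j :=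
  le_antisymm (not_lt.1 fun h => hi.2 j h hj.1) (not_lt.1 fun h => hj.2 i h hi.1)

/-- For `n = 0` the radius `8 * n` vanishes, so every vertex is a hub. Hence the set defining
`level` is never empty. -/
lemma onPath_zero (ω : Γ → unitInterval) (x : Γ) : OnPath a 0 ω x :=
  ⟨0, (em (low 0 ω x)).imp id fun h => h⟩

/-- Each step of a path lowers the distance to the next hubs by at least one; this bounds the length
of paths. -/
lemma flow_le (ha : ∀ i, a i * a i = 1) {n j : ℕ} {ω : Γ → unitInterval} {x : Γ}
    (h : flow a n ω j x) : hubDist a n ω x + j ≤ 8 * (n + 1) := by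
  induction j generalizing x with
  | zero => exact hubDist_le n ω x
  | succ j ih =>
    obtain ⟨i, hi, h⟩ := h
    have h1 := hi.1
    rw [mul_assoc, ha, mul_one] at h1
    have := ih h
    omega

/-- Vertices can be directed to a neighbour with larger level and height. -/
lemma exists_lex_lt [Finite ι] (ha : ∀ i, a i * a i = 1) {ω : Γ → unitInterval}
    (hω : ∀ x, BddAbove {n | OnPath a n ω x}) (x : Γ) :
    ∃ i, level a ω x < level a ω (x * a i) ∨
      level a ω x = level a ω (x * a i) ∧ height a ω x < height a ω (x * a i) := by
  have hx : OnPath a (level a ω x) ω x := Nat.sSup_mem ⟨0, onPath_zero ω x⟩ (hω x)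
  -- A hub of the next index would start a path of higher level, so the path through `x` has not
  -- ended yet.
  have hx' : ¬ hub a (level a ω x + 1) ω x := fun h => by
    have : level a ω x + 1 ≤ level a ω x := le_csSup (hω x) ⟨0, h⟩
    omega
  obtain ⟨i, hi⟩ := exists_descends hx'
  obtain ⟨j, hj⟩ := hx
  have hxi : x * a i * a i = x := by rw [mul_assoc, ha, mul_one]
  -- The descending step from `x` prolongs its path, which therefore also passes through `x * a i`.
  have hle : level a ω x ≤ level a ω (x * a i) :=
    le_csSup (hω _) ⟨j + 1, i, by rwa [hxi], by rwa [hxi]⟩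
  refine ⟨i, hle.lt_or_eq.imp id fun h => ⟨h, ?_⟩⟩
  have h1 := hi.1
  -- This bound keeps the subtraction in `height` from being truncated, so a smaller distance gives
  -- a larger height.
  have h2 := hubDist_le (a := a) (level a ω x) ω x
  rw [height, height, ← h]
  omega

/-! Equivariance -/

lemma descends_shift (n : ℕ) (ω : Γ → unitInterval) (g x : Γ) (i : ι) :
    Descends a n (shift g ω) x i ↔ Descends a n ω (g⁻¹ * x) i := by
  simp only [Descends, hubDist_shift, mul_assoc]

lemma flow_shift (n : ℕ) (ω : Γ → unitInterval) (g : Γ) (j : ℕ) (x : Γ) :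
    flow a n (shift g ω) j x ↔ flow a n ω j (g⁻¹ * x) := by
  induction j generalizing x with
  | zero => exact hub_shift n ω g x
  | succ j ih => simp only [flow, ih, descends_shift, mul_assoc]

lemma level_shift (ω : Γ → unitInterval) (g x : Γ) :
    level a (shift g ω) x = level a ω (g⁻¹ * x) := by
  simp only [level, OnPath, flow_shift]

lemma height_shift (ω : Γ → unitInterval) (g x : Γ) :
    height a (shift g ω) x = height a ω (g⁻¹ * x) := by
  simp only [height, level_shift, hubDist_shift]

/-! Measurability -/

lemma measurable_descends [Countable ι] (n : ℕ) (x : Γ) (i : ι) :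
    Measurable fun ω : Γ → unitInterval => Descends a n ω x i := by
  have h : ∀ i, Measurable fun ω : Γ → unitInterval =>
      hubDist a n ω (x * a i) < hubDist a n ω x := fun i =>
    measurableSet_setOfPred.1 (measurableSet_lt (measurable_hubDist n _) (measurable_hubDist n _))
  exact (h i).and (Measurable.forall fun j => measurable_const.imp (h j).not)

lemma measurable_flow [Countable ι] (n j : ℕ) (x : Γ) :
    Measurable fun ω : Γ → unitInterval => flow a n ω j x := by
  induction j generalizing x with
  | zero => exact measurable_hub n x
  | succ j ih => exact Measurable.exists fun i => (measurable_descends n _ i).and (ih _)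

lemma measurable_level [Countable ι] (x : Γ) :
    Measurable fun ω : Γ → unitInterval => level a ω x :=
  measurable_sSup_nat fun n => Measurable.exists fun j => measurable_flow n j x

lemma measurable_height [Countable ι] (x : Γ) :
    Measurable fun ω : Γ → unitInterval => height a ω x := by
  -- `hubDist` is evaluated at the random index `level`, hence the detour through the whole
  -- sequence.
  have h : Measurable fun ω : Γ → unitInterval => fun n => hubDist a n ω x :=
    measurable_pi_lambda _ fun n => measurable_hubDist n x
  exact ((measurable_level x).add_const 1 |>.const_mul 8).sub
    ((measurable_from_prod_countable_left (f := fun p : (ℕ → ℕ) × ℕ => p.1 p.2)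
      (fun n => measurable_pi_apply n)).comp (h.prodMk (measurable_level x)))

end Flow

/-! ### Almost surely, levels are finite -/

section MassTransport

variable {Γ : Type*} [Group Γ] {ι : Type*} [LinearOrder ι] [Fintype ι] {a : ι → Γ}
  {μ : Measure (Γ → unitInterval)}

lemma measurable_shift {A : Type*} [MeasurableSpace A] (g : Γ) :
    Measurable (shift g : (Γ → A) → Γ → A) :=
  measurable_pi_lambda _ fun _ => measurable_pi_apply _

/-- The probability of an equivariant event does not depend on the vertex. -/
lemma measure_equivariant (hμ : IsShiftInvariant μ) {P : (Γ → unitInterval) → Γ → Prop}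
    (hP : ∀ ω g x, P (shift g ω) x ↔ P ω (g⁻¹ * x)) (hm : ∀ x, Measurable fun ω => P ω x) (x : Γ) :
    μ {ω | P ω x} = μ {ω | P ω 1} := by
  conv_lhs => rw [← hμ x]
  rw [Measure.map_apply (measurable_shift x) (measurableSet_setOfPred.2 (hm x))]
  simp [Set.preimage, hP]

/-- Mass transport: every vertex passes its mass along at most one direction, so by invariance the
expected mass received equals the mass sent, and it cannot grow with `j`. -/
lemma measure_flow_le (hμ : IsShiftInvariant μ) (n j : ℕ) (x : Γ) :
    μ {ω | flow a n ω j x} ≤ μ {ω | hub a n ω 1} := by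
  induction j generalizing x with
  | zero =>
    exact (measure_equivariant hμ (fun ω g x => hub_shift n ω g x) (measurable_hub n) x).le
  | succ j ih =>
    let P : ι → (Γ → unitInterval) → Γ → Prop := fun i ω y => Descends a n ω y i ∧ flow a n ω j y
    have hP : ∀ i y, Measurable fun ω => P i ω y := fun i y =>
      (measurable_descends n y i).and (measurable_flow n j y)
    calc μ {ω | flow a n ω (j + 1) x}
        ≤ μ (⋃ i, {ω | P i ω (x * a i)}) :=
          measure_mono fun ω ⟨i, hi⟩ => Set.mem_iUnion.2 ⟨i, hi⟩
      _ ≤ ∑ i, μ {ω | P i ω (x * a i)} := measure_iUnion_fintype_le _ _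
      _ = ∑ i, μ {ω | P i ω 1} := Finset.sum_congr rfl fun i _ =>
          measure_equivariant hμ (fun ω g x => and_congr (descends_shift n ω g x i)
            (flow_shift n ω g j x)) (hP i) _
      _ = μ (⋃ i, {ω | P i ω 1}) := by
          rw [measure_iUnion _ fun i => measurableSet_setOfPred.2 (hP i 1), tsum_fintype]
          exact fun i k hik => Set.disjoint_left.2 fun ω hi hk => hik (hi.1.unique hk.1)
      _ ≤ μ {ω | flow a n ω j 1} :=
          measure_mono (Set.iUnion_subset fun i ω h => h.2)
      _ ≤ μ {ω | hub a n ω 1} := ih 1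

/-- Positions on a path satisfy `j ≤ 8 * (n + 1)` by `flow_le`, which leaves `8 * n + 9` values. -/
lemma measure_onPath_le (ha : ∀ i, a i * a i = 1) (hμ : IsShiftInvariant μ) (n : ℕ) (x : Γ) :
    μ {ω | OnPath a n ω x} ≤ (8 * n + 9 : ℕ) * μ {ω | hub a n ω 1} := by
  calc μ {ω | OnPath a n ω x}
      ≤ μ (⋃ j ∈ Finset.range (8 * n + 9), {ω | flow a n ω j x}) := by
        refine measure_mono fun ω ⟨j, hj⟩ => ?_
        have := flow_le ha hj
        exact Set.mem_biUnion (Finset.mem_coe.2 (Finset.mem_range.2 (by omega))) hj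
    _ ≤ ∑ j ∈ Finset.range (8 * n + 9), μ {ω | flow a n ω j x} := measure_biUnion_finset_le _ _
    _ ≤ ∑ _j ∈ Finset.range (8 * n + 9), μ {ω | hub a n ω 1} :=
        Finset.sum_le_sum fun j _ => measure_flow_le hμ n j x
    _ = (8 * n + 9 : ℕ) * μ {ω | hub a n ω 1} := by simp

/-- If hubs are rare, almost surely each vertex lies on paths of finitely many levels only. -/
lemma ae_bddAbove_onPath [Countable Γ] (ha : ∀ i, a i * a i = 1) (hμ : IsShiftInvariant μ)
    (h : ∀ n, μ {ω | hub a n ω 1} ≤ ENNReal.ofReal (4 * (1 / 4) ^ n)) :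
    ∀ᵐ ω ∂μ, ∀ x, BddAbove {n | OnPath a n ω x} := by
  refine ae_all_iff.2 fun x => ?_
  have hle : ∀ n, μ {ω | OnPath a n ω x} ≤
      ENNReal.ofReal ((8 * n + 9 : ℕ) * (4 * (1 / 4) ^ n)) := fun n => by
    rw [ENNReal.ofReal_mul (by positivity), ENNReal.ofReal_natCast]
    exact (measure_onPath_le ha hμ n x).trans (by gcongr; exact h n)
  have hs : Summable fun n : ℕ => ((8 * n + 9 : ℕ) : ℝ) * (4 * (1 / 4) ^ n) := by
    -- The coefficients come from `4 * (8 n + 9) = 32 n + 36`.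
    have h1 := (summable_pow_mul_geometric_of_norm_lt_one 1
      (r := (1 / 4 : ℝ)) (by norm_num)).mul_left 32
    have h2 := (summable_geometric_of_lt_one (r := (1 / 4 : ℝ)) (by norm_num)
      (by norm_num)).mul_left 36
    refine (h1.add h2).congr fun n => ?_
    push_cast
    ring
  have hsum : ∑' n, μ {ω | OnPath a n ω x} ≠ ⊤ :=
    ne_top_of_le_ne_top hs.tsum_ofReal_ne_top (ENNReal.tsum_le_tsum hle)
  filter_upwards [ae_eventually_notMem hsum] with ω hω
  obtain ⟨N, hN⟩ := Filter.eventually_atTop.1 hω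
  exact ⟨N, fun n hn => (not_lt.1 fun hlt => hN n hlt.le hn)⟩

end MassTransport

/-! ### Uniform i.i.d. labels -/

section Uniform

variable {Γ : Type*}

instance : IsProbabilityMeasure (iidUniform Γ) := by
  unfold iidUniform
  infer_instance

lemma iidUniform_eval_lt (x : Γ) {t : ℝ} (ht : t ∈ unitInterval) :
    iidUniform Γ {ω | (ω x : ℝ) < t} = ENNReal.ofReal t := by
  rw [← unitInterval.volume_Iio ⟨t, ht⟩,
    ← (measurePreserving_eval_infinitePi (fun _ : Γ => (volume : Measure unitInterval))
      x).measure_preimage measurableSet_Iio.nullMeasurableSet]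
  rfl

lemma iidUniform_forall_le (W : Finset Γ) {t : ℝ} (ht : t ∈ unitInterval) :
    iidUniform Γ {ω | ∀ w ∈ W, t ≤ (ω w : ℝ)} = ENNReal.ofReal ((1 - t) ^ W.card) := by
  have : {ω : Γ → unitInterval | ∀ w ∈ W, t ≤ (ω w : ℝ)} =
      Set.pi W fun _ => Set.Ici ⟨t, ht⟩ := by
    ext ω
    simp [Set.mem_pi, ← Subtype.coe_le_coe]
  rw [this, iidUniform, Measure.infinitePi_pi _ fun _ _ => measurableSet_Ici]
  simp [unitInterval.volume_Ici, ENNReal.ofReal_pow (sub_nonneg.2 ht.2)]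

lemma ae_injective_iidUniform [Countable Γ] :
    ∀ᵐ ω ∂iidUniform Γ, Function.Injective ω := by
  have key : ∀ x y : Γ, x ≠ y → ∀ᵐ ω ∂iidUniform Γ, ω x ≠ ω y := fun x y hxy => by
    have hind : ProbabilityTheory.IndepFun (fun ω : Γ → unitInterval => ω x) (fun ω => ω y)
        (iidUniform Γ) :=
      (ProbabilityTheory.iIndepFun_infinitePi (P := fun _ : Γ => (volume : Measure unitInterval))
        (X := fun _ u => u) fun _ => measurable_id).indepFun hxy
    have hlaw := (ProbabilityTheory.indepFun_iff_map_prod_eq_prod_map_map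
      (measurable_pi_apply x).aemeasurable (measurable_pi_apply y).aemeasurable).1 hind
    have hx : ∀ z : Γ, (iidUniform Γ).map (fun ω => ω z) = volume := fun z =>
      Measure.infinitePi_map_eval _ z
    rw [hx, hx] at hlaw
    have hd : MeasurableSet {p : unitInterval × unitInterval | p.1 ≠ p.2} :=
      (measurableSet_eq_fun measurable_fst measurable_snd).compl
    have : ∀ᵐ p ∂((volume : Measure unitInterval).prod volume), p.1 ≠ p.2 := by
      rw [Measure.ae_prod_iff_ae_ae hd]
      refine Filter.Eventually.of_forall fun u => ?_
      filter_upwards [compl_mem_ae_iff.2 (measure_singleton (μ := volume) u)] with v hv h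
      exact hv h.symm
    rw [← hlaw] at this
    exact ae_of_ae_map ((measurable_pi_apply x).prodMk (measurable_pi_apply y)).aemeasurable this
  have : ∀ᵐ ω ∂iidUniform Γ, ∀ x y, x ≠ y → ω x ≠ ω y :=
    ae_all_iff.2 fun x => ae_all_iff.2 fun y => by
      by_cases h : x = y
      · simp [h]
      · filter_upwards [key x y h] with ω hω _ using hω
  filter_upwards [this] with ω hω x y h
  by_contra hne
  exact hω x y hne h

lemma isShiftInvariant_iidUniform [Group Γ] : IsShiftInvariant (iidUniform Γ) := fun g => by
  refine Measure.eq_infinitePi _ fun s t ht => ?_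
  classical
  have hpre : shift g ⁻¹' (Set.pi s t) = Set.pi (s.image (g⁻¹ * ·) : Finset Γ)
      (fun x => t (g * x) : Γ → Set unitInterval) := by
    ext x
    simp only [Set.mem_preimage, Set.mem_pi, Finset.mem_coe, Finset.mem_image, shift]
    refine ⟨?_, fun h i hi => ?_⟩
    · rintro h _ ⟨i, hi, rfl⟩
      simpa using h i hi
    · simpa using h _ ⟨i, hi, rfl⟩
  rw [Measure.map_apply (measurable_shift g) (.pi s.countable_toSet fun _ _ => ht _), hpre,
    iidUniform, Measure.infinitePi_pi _ fun _ _ => ht _,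
    Finset.prod_image fun x _ y _ h => mul_left_cancel h]
  simp

end Uniform

/-! ### Proper labellings by natural numbers -/

section Label

variable {Γ : Type*} [Group Γ] (E : Set Γ)

lemma exists_separating_sequence : ∃ U : ℕ → Set unitInterval, (∀ n, MeasurableSet (U n)) ∧
    ∀ (u : unitInterval) (s : Set unitInterval), s.Finite → u ∉ s →
      ∃ n, u ∈ U n ∧ ∀ v ∈ s, v ∉ U n := by
  have hB := TopologicalSpace.isBasis_countableBasis unitInterval
  obtain ⟨V, hV, -⟩ := hB.exists_subset_of_mem_open (Set.mem_univ 0) isOpen_univ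
  obtain ⟨U, hU⟩ :=
    (TopologicalSpace.countable_countableBasis unitInterval).exists_eq_range ⟨V, hV⟩
  refine ⟨U, fun n => (hB.isOpen (hU ▸ Set.mem_range_self n)).measurableSet, fun u s hs hu => ?_⟩
  obtain ⟨v, hv, huv, hvs⟩ := hB.exists_subset_of_mem_open (Set.mem_compl hu)
    hs.isClosed.isOpen_compl
  rw [hU] at hv
  obtain ⟨n, rfl⟩ := hv
  exact ⟨n, huv, fun w hw hwn => hvs hwn hw⟩

/-- A sequence of measurable sets which separates points from finite sets. -/
def separating : ℕ → Set unitInterval := exists_separating_sequence.choose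

/-- The first `n` such that the `n`-th separating set separates the label of `x` from those of its
neighbours. -/
def label (ω : Γ → unitInterval) (x : Γ) : ℕ :=
  sInf {n | ω x ∈ separating n ∧ ∀ s ∈ E, ω (x * s) ∉ separating n}

variable {E}

/-- If both labels were `n`, the `n`-th separating set would contain the value at `x * s` and also
exclude it. -/
lemma label_ne (hE : E.Finite) (hE' : 1 ∉ E) {ω : Γ → unitInterval}
    (hω : Function.Injective ω) {x s : Γ} (hs : s ∈ E) :
    label E ω x ≠ label E ω (x * s) := by
  have hne : ∀ y, label E ω y ∈
      {n | ω y ∈ separating n ∧ ∀ s ∈ E, ω (y * s) ∉ separating n} := fun y => by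
    refine Nat.sInf_mem ?_
    obtain ⟨n, h1, h2⟩ := exists_separating_sequence.choose_spec.2 (ω y)
      ((fun s => ω (y * s)) '' E) (hE.image _) (by
        rintro ⟨s, hs, h⟩
        exact hE' (mul_eq_left.1 (hω h) ▸ hs))
    exact ⟨n, h1, fun s hs => h2 _ ⟨s, hs, rfl⟩⟩
  intro h
  have := (hne (x * s)).1
  rw [← h] at this
  exact (hne x).2 s hs this

lemma label_shift (ω : Γ → unitInterval) (g x : Γ) :
    label E (shift g ω) x = label E ω (g⁻¹ * x) := by
  simp only [label, shift, mul_assoc]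

lemma measurable_label [Countable Γ] (x : Γ) :
    Measurable fun ω : Γ → unitInterval => label E ω x := by
  have h : ∀ n (y : Γ), Measurable fun ω : Γ → unitInterval => ω y ∈ separating n := fun n y =>
    measurableSet_setOfPred.1
      (measurable_pi_apply y (exists_separating_sequence.choose_spec.1 n))
  exact measurable_sInf_nat fun n => (h n x).and
    (Measurable.forall fun s => measurable_const.imp (h n _).not)

end Label

/-! ### Growth of `C₂ * C₂ * C₂` -/

section Growth

lemma genA_mul_self (i : Fin 3) : genA i * genA i = 1 := by
  refine Prod.ext ?_ rfl
  rw [genA, Prod.fst_mul, ← map_mul, ← ofAdd_add]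
  exact map_one _

/-- The image of a word in the free semigroup generated by `a₁ a₂` and `a₁ a₃`. -/
def semigroupWord (l : List Bool) : Gam :=
  (l.map fun c => genA 0 * genA (if c then 1 else 2)).prod

lemma near_of_semigroupWord {P : Gam → Prop} (l : List Bool) (x : Gam)
    (h : P (x * semigroupWord l)) : near genA P (2 * l.length) x := by
  induction l generalizing x with
  | nil => simpa [semigroupWord, near] using h
  | cons c l ih =>
    refine Or.inr ⟨0, Or.inr ⟨if c then 1 else 2, ih _ ?_⟩⟩
    simpa [semigroupWord, mul_assoc] using h

/-- The letters of `semigroupWord l`. -/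
def semigroupLetters (l : List Bool) : List (Σ _ : Fin 3, Multiplicative (ZMod 2)) :=
  l.flatMap fun c => [⟨0, .ofAdd 1⟩, ⟨if c then 1 else 2, .ofAdd 1⟩]

/-- The second letter of each pair determines the Boolean it came from. -/
lemma semigroupLetters_injective : Function.Injective semigroupLetters := by
  intro l
  induction l with
  | nil => intro l' h; cases l' <;> simp_all [semigroupLetters]
  | cons c l ih =>
    intro l' h
    cases l' with
    | nil => simp [semigroupLetters] at h
    | cons c' l' =>
      simp only [semigroupLetters, List.flatMap_cons, List.cons_append, List.nil_append,
        List.cons.injEq, true_and] at h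
      have h1 : c = c' := by
        have := congrArg Sigma.fst h.1
        cases c <;> cases c' <;> simp_all
      rw [h1, ih h.2]

/-- `semigroupLetters l` as a reduced word. -/
def reducedWord (l : List Bool) :
    Monoid.CoprodI.Word fun _ : Fin 3 => Multiplicative (ZMod 2) where
  toList := semigroupLetters l
  ne_one := by
    intro p hp
    simp only [semigroupLetters, List.mem_flatMap, List.mem_cons, List.not_mem_nil, or_false] at hp
    obtain ⟨c, -, rfl | rfl⟩ := hp <;> exact (by decide : (1 : ZMod 2) ≠ 0)
  chain_ne := by
    induction l with
    | nil => exact List.IsChain.nil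
    | cons c l ih =>
      have h2 : (0 : Fin 3) ≠ if c then 1 else 2 := by cases c <;> decide
      cases l with
      | nil => simpa [semigroupLetters] using h2
      | cons d l =>
        simp only [semigroupLetters, List.flatMap_cons, List.cons_append, List.nil_append,
          List.isChain_cons_cons] at ih ⊢
        exact ⟨h2, h2.symm, ih⟩

lemma semigroupWord_fst (l : List Bool) : (semigroupWord l).1 = (reducedWord l).prod := by
  induction l with
  | nil => rfl
  | cons c l ih =>
    have h1 : semigroupWord (c :: l) = genA 0 * genA (if c then 1 else 2) * semigroupWord l := by
      simp [semigroupWord]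
    rw [h1, Prod.fst_mul, ih]
    simp [Monoid.CoprodI.Word.prod, reducedWord, semigroupLetters, genA, mul_assoc]

/-- The letters already form a reduced word, so uniqueness of normal forms in the free product makes
the semigroup free. -/
lemma semigroupWord_injective : Function.Injective semigroupWord := fun l l' h => by
  have h1 := congrArg Prod.fst h
  rw [semigroupWord_fst, semigroupWord_fst] at h1
  exact semigroupLetters_injective
    (congrArg Monoid.CoprodI.Word.toList (Monoid.CoprodI.Word.equiv.symm.injective h1))

/-- Products of `4 n` free semigroup generators, each of length two, give `2 ^ (4 n) = 16 ^ n`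
points within distance `8 n`: enough to beat the density `4⁻ⁿ` of low labels. -/
lemma exists_card_eq_of_near (n : ℕ) : ∃ W : Finset Gam, W.card = 16 ^ n ∧
    ∀ (P : Gam → Prop) (x : Gam), ∀ w ∈ W, P (x * w) → near genA P (8 * n) x := by
  classical
  refine ⟨Finset.univ.image fun f : Fin (4 * n) → Bool => semigroupWord (List.ofFn f), ?_, ?_⟩
  · have hinj : Function.Injective fun f : Fin (4 * n) → Bool => semigroupWord (List.ofFn f) :=
      semigroupWord_injective.comp List.ofFn_injective
    rw [Finset.card_image_of_injective _ hinj]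
    simp [pow_mul]
  · intro P x w hw h
    obtain ⟨f, -, rfl⟩ := Finset.mem_image.1 hw
    have := near_of_semigroupWord _ _ h
    rw [List.length_ofFn] at this
    rwa [show 8 * n = 2 * (4 * n) by ring]

end Growth

/-! ### Minimal labels in triangles -/

section Triangle

lemma genB_mul (x : Gam) : genB * x = x * genB :=
  Prod.ext (by simp [genB]) (mul_comm _ _)

lemma mul_genB_right_comm (x y : Gam) : x * y * genB = x * genB * y := by
  rw [mul_assoc, ← genB_mul, mul_assoc]

lemma mul_genB_inv_right_comm (x y : Gam) : x * y * genB⁻¹ = x * genB⁻¹ * y := by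
  rw [mul_inv_eq_iff_eq_mul, mul_genB_right_comm, inv_mul_cancel_right]

lemma genB_mul_genB : genB * genB = genB⁻¹ := Prod.ext (by simp [genB]) (by decide)

lemma genB_inv_mul_genB_inv : genB⁻¹ * genB⁻¹ = genB := Prod.ext (by simp [genB]) (by decide)

/-- The minimal label in the triangle of `x`. -/
def triMin (ω : Gam → unitInterval) (x : Gam) : unitInterval :=
  ω x ⊓ (ω (x * genB) ⊓ ω (x * genB⁻¹))

lemma triMin_shift (ω : Gam → unitInterval) (g : Gam) :
    triMin (shift g ω) = shift g (triMin ω) := by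
  funext x
  simp only [triMin, shift, mul_assoc]

lemma triMin_mul_genB (ω : Gam → unitInterval) (x : Gam) : triMin ω (x * genB) = triMin ω x := by
  rw [triMin, triMin, mul_assoc, mul_assoc, genB_mul_genB, mul_inv_cancel, mul_one,
    ← inf_assoc, inf_comm]

/-- Since `b` is central, moving within a triangle is a shift. Equivariance then makes everything
computed from `triMin` constant on triangles. -/
lemma shift_genB_triMin (ω : Gam → unitInterval) : shift genB⁻¹ (triMin ω) = triMin ω := by
  funext x
  rw [shift, inv_inv, genB_mul, triMin_mul_genB]

lemma level_triMin_mul_genB (ω : Gam → unitInterval) (x : Gam) :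
    level genA (triMin ω) (x * genB) = level genA (triMin ω) x := by
  conv_rhs => rw [← shift_genB_triMin, level_shift, inv_inv, genB_mul]

lemma height_triMin_mul_genB (ω : Gam → unitInterval) (x : Gam) :
    height genA (triMin ω) (x * genB) = height genA (triMin ω) x := by
  conv_rhs => rw [← shift_genB_triMin, height_shift, inv_inv, genB_mul]

lemma measurable_triMin : Measurable triMin :=
  measurable_pi_lambda _ fun _ => (measurable_pi_apply _).inf
    ((measurable_pi_apply _).inf (measurable_pi_apply _))

instance : Countable C2FreeCube :=
  have : Function.Injective
      (Monoid.CoprodI.Word.toList (M := fun _ : Fin 3 => Multiplicative (ZMod 2))) :=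
    fun _ _ => Monoid.CoprodI.Word.ext
  (this.comp Monoid.CoprodI.Word.equiv.injective).countable

lemma isShiftInvariant_map {A B : Type*} [MeasurableSpace A] [MeasurableSpace B] {Γ : Type*}
    [Group Γ] {μ : Measure (Γ → A)} (hμ : IsShiftInvariant μ) {F : (Γ → A) → Γ → B}
    (hF : Measurable F) (hF' : ∀ ω g, F (shift g ω) = shift g (F ω)) :
    IsShiftInvariant (μ.map F) := fun g => by
  rw [Measure.map_map (measurable_shift g) hF]
  conv_rhs => rw [← hμ g, Measure.map_map hF (measurable_shift g)]
  exact congrArg (fun G => μ.map G) (funext fun ω => (hF' ω g).symm)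

/-- Three of the four terms bound a low label in the triangle of `1`. The fourth bounds the absence
of low labels nearby; as `triMin ω ≤ ω`, it suffices to test the independent labels on `W`. -/
lemma measure_hub_triMin_le (n : ℕ) :
    (iidUniform Gam).map triMin {ω | hub genA n ω 1} ≤ ENNReal.ofReal (4 * (1 / 4) ^ n) := by
  have ht : (1 / 4 : ℝ) ^ n ∈ unitInterval :=
    ⟨by positivity, pow_le_one₀ (by norm_num) (by norm_num)⟩
  obtain ⟨W, hcard, hW⟩ := exists_card_eq_of_near n
  rw [Measure.map_apply measurable_triMin (measurableSet_setOfPred.2 (measurable_hub n 1))]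
  -- With `16 ^ n` points the left side is at most `exp (-4 ^ n)`, and `exp t ≥ t` for `t = 4 ^ n`.
  have hexp : (1 - (1 / 4 : ℝ) ^ n) ^ W.card ≤ (1 / 4) ^ n := by
    have h1 : (1 - (1 / 4 : ℝ) ^ n) ^ W.card ≤ Real.exp (-4 ^ n) := by
      calc (1 - (1 / 4 : ℝ) ^ n) ^ W.card
          ≤ Real.exp (-(1 / 4) ^ n) ^ W.card :=
            pow_le_pow_left₀ (sub_nonneg.2 ht.2) (Real.one_sub_le_exp_neg _) _
        _ = Real.exp (-4 ^ n) := by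
            rw [← Real.exp_nat_mul, hcard]
            congr 1
            push_cast
            rw [mul_neg, ← mul_pow]
            norm_num
    refine h1.trans ?_
    rw [Real.exp_neg, one_div, inv_pow]
    gcongr
    linarith [Real.add_one_le_exp ((4 : ℝ) ^ n)]
  let A : Gam → Set (Gam → unitInterval) := fun x => {ω | (ω x : ℝ) < (1 / 4) ^ n}
  have hsub : triMin ⁻¹' {ω | hub genA n ω 1} ⊆ (A 1 ∪ (A genB ∪ A genB⁻¹)) ∪
      {ω | ∀ w ∈ W, (1 / 4) ^ n ≤ (ω w : ℝ)} := by
    rintro ω (h | h)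
    · left
      simpa [low, triMin, A] using h
    · right
      intro w hw
      by_contra! hlt
      refine h (hW _ _ w hw ?_)
      rw [one_mul]
      exact lt_of_le_of_lt (Subtype.coe_le_coe.2 inf_le_left) hlt
  calc iidUniform Gam (triMin ⁻¹' {ω | hub genA n ω 1})
      ≤ (iidUniform Gam (A 1) + (iidUniform Gam (A genB) + iidUniform Gam (A genB⁻¹))) +
          iidUniform Gam {ω | ∀ w ∈ W, (1 / 4) ^ n ≤ (ω w : ℝ)} :=
        (measure_mono hsub).trans <| (measure_union_le _ _).trans <| by
          gcongr
          exact (measure_union_le _ _).trans (by gcongr; exact measure_union_le _ _)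
    _ ≤ (ENNReal.ofReal ((1 / 4) ^ n) + (ENNReal.ofReal ((1 / 4) ^ n) +
          ENNReal.ofReal ((1 / 4) ^ n))) + ENNReal.ofReal ((1 / 4) ^ n) := by
        simp only [A, iidUniform_eval_lt _ ht, iidUniform_forall_le W ht]
        gcongr
    _ = ENNReal.ofReal (4 * (1 / 4) ^ n) := by
        have := ht.1
        rw [← ENNReal.ofReal_add this this, ← ENNReal.ofReal_add this (by positivity),
          ← ENNReal.ofReal_add (by positivity) this]
        congr 1
        ring

lemma ae_bddAbove_onPath_triMin :
    ∀ᵐ ω ∂iidUniform Gam, ∀ x, BddAbove {n | OnPath genA n (triMin ω) x} :=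
  ae_of_ae_map measurable_triMin.aemeasurable <|
    ae_bddAbove_onPath genA_mul_self
      (isShiftInvariant_map isShiftInvariant_iidUniform measurable_triMin triMin_shift)
      measure_hub_triMin_le

end Triangle

/-! ### The colouring -/

section Coloring

/-- The key of `x` in the greedy algorithm. -/
def key (ω : Gam → unitInterval) (x : Gam) : ℕ × ℕ × ℕ :=
  (level genA (triMin ω) x, height genA (triMin ω) x, label gens ω x)

/-- The lexicographic order of keys. -/
def keyLT : ℕ × ℕ × ℕ → ℕ × ℕ × ℕ → Prop :=
  Prod.Lex (· < ·) (Prod.Lex (· < ·) (· < ·))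

lemma wellFounded_keyLT : WellFounded keyLT :=
  WellFounded.prod_lex wellFounded_lt (WellFounded.prod_lex wellFounded_lt wellFounded_lt)

lemma keyLT_or_of_ne {p q : ℕ × ℕ × ℕ} (h : p.2.2 ≠ q.2.2) : keyLT p q ∨ keyLT q p := by
  simp only [keyLT, Prod.lex_def]
  omega

lemma key_shift (ω : Gam → unitInterval) (g : Gam) : key (shift g ω) = shift g (key ω) := by
  funext x
  simp only [key, triMin_shift, level_shift, height_shift, label_shift, shift]

lemma measurable_key (x : Gam) : Measurable fun ω => key ω x :=
  ((measurable_level x).comp measurable_triMin).prodMk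
    (((measurable_height x).comp measurable_triMin).prodMk (measurable_label x))

/-- The greedy independent set. It almost surely meets each triangle in one point. -/
def InTransversal (ω : Gam → unitInterval) (x : Gam) : Prop := Selected gens keyLT (key ω) x

lemma inTransversal_shift (ω : Gam → unitInterval) (g x : Gam) :
    InTransversal (shift g ω) x ↔ InTransversal ω (g⁻¹ * x) := by
  rw [InTransversal, key_shift, selected_shift, InTransversal]

lemma finite_gens : gens.Finite := by
  unfold gens
  exact Set.toFinite _

lemma genA_ne_one (i : Fin 3) : genA i ≠ 1 := fun h => by
  have h1 := congrArg Prod.fst h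
  have h2 := Monoid.CoprodI.of_injective (M := fun _ : Fin 3 => Multiplicative (ZMod 2)) i
    (h1.trans (map_one _).symm)
  exact absurd h2 (by decide : (1 : ZMod 2) ≠ 0)

lemma genB_ne_one : genB ≠ 1 := fun h =>
  absurd (congrArg Prod.snd h) (by decide : (1 : ZMod 3) ≠ 0)

lemma genB_mem : genB ∈ gens := by simp [gens]

lemma genB_inv_mem : genB⁻¹ ∈ gens := by simp [gens]

lemma mem_gens {s : Gam} : s ∈ gens ↔ (∃ i, s = genA i) ∨ s = genB ∨ s = genB⁻¹ := by
  simp [gens, Fin.exists_fin_succ, or_assoc]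

lemma one_notMem_gens : 1 ∉ gens := fun h => by
  rcases mem_gens.1 h with ⟨i, h⟩ | h | h
  · exact genA_ne_one i h.symm
  · exact genB_ne_one h.symm
  · exact genB_ne_one (inv_eq_one.1 h.symm)

lemma inv_mem_gens {s : Gam} (hs : s ∈ gens) : s⁻¹ ∈ gens := by
  rcases mem_gens.1 hs with ⟨i, rfl⟩ | rfl | rfl
  · rw [inv_eq_of_mul_eq_one_left (genA_mul_self i)]
    exact hs
  · exact genB_inv_mem
  · rw [inv_inv]
    exact genB_mem

variable {ω : Gam → unitInterval}

lemma InTransversal.not_mul (hω : Function.Injective ω) {x s : Gam} (hs : s ∈ gens)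
    (hx : InTransversal ω x) : ¬ InTransversal ω (x * s) := fun h => by
  rcases keyLT_or_of_ne (p := key ω x) (q := key ω (x * s))
    (label_ne finite_gens one_notMem_gens hω hs) with hlt | hlt
  · refine not_selected_of_selected (inv_mem_gens hs) ?_ h ?_ <;> rwa [mul_inv_cancel_right]
  · exact not_selected_of_selected hs hlt hx h

/-- If the greedy set misses a triangle, each vertex is blocked by the `i`-th neighbour for some
`i` which is not the direction of increasing keys. -/
lemma exists_blocking {x : Gam} {i : Fin 3}
    (hi : level genA (triMin ω) x < level genA (triMin ω) (x * genA i) ∨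
      level genA (triMin ω) x = level genA (triMin ω) (x * genA i) ∧
        height genA (triMin ω) x < height genA (triMin ω) (x * genA i))
    (h0 : ¬ InTransversal ω x) (h1 : ¬ InTransversal ω (x * genB))
    (h2 : ¬ InTransversal ω (x * genB⁻¹)) : ∃ j, j ≠ i ∧ InTransversal ω (x * genA j) := by
  rcases selected_or (κ := key ω) finite_gens wellFounded_keyLT x with h | ⟨s, hs, hlt, h⟩
  · exact absurd h h0
  rcases mem_gens.1 hs with ⟨j, rfl⟩ | rfl | rfl
  · refine ⟨j, ?_, h⟩
    rintro rfl
    simp only [keyLT, Prod.lex_def, key] at hlt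
    omega
  · exact absurd h h1
  · exact absurd h h2

lemma exists_inTransversal (hω : Function.Injective ω)
    (hb : ∀ x, BddAbove {n | OnPath genA n (triMin ω) x}) (x : Gam) :
    InTransversal ω x ∨ InTransversal ω (x * genB) ∨ InTransversal ω (x * genB⁻¹) := by
  by_contra! h
  obtain ⟨h0, h1, h2⟩ := h
  obtain ⟨i, hi⟩ := exists_lex_lt genA_mul_self hb x
  have hB : ∀ y, level genA (triMin ω) (y * genB⁻¹) = level genA (triMin ω) y := fun y => by
    rw [← level_triMin_mul_genB, inv_mul_cancel_right]
  have hB' : ∀ y, height genA (triMin ω) (y * genB⁻¹) = height genA (triMin ω) y := fun y => by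
    rw [← height_triMin_mul_genB, inv_mul_cancel_right]
  -- Level and height are constant on the triangle, so the same increasing direction `i` is
  -- forbidden to all three blockers.
  obtain ⟨j0, hj0, k0⟩ := exists_blocking hi h0 h1 h2
  obtain ⟨j1, hj1, k1⟩ := exists_blocking (x := x * genB) (i := i)
    (by simpa only [← mul_genB_right_comm, level_triMin_mul_genB, height_triMin_mul_genB] using hi)
    h1 (by rwa [mul_assoc, genB_mul_genB]) (by rwa [mul_inv_cancel_right])
  obtain ⟨j2, hj2, k2⟩ := exists_blocking (x := x * genB⁻¹) (i := i)
    (by simpa only [← mul_genB_inv_right_comm, hB, hB'] using hi) h2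
    (by rwa [inv_mul_cancel_right]) (by rwa [mul_assoc, genB_inv_mul_genB_inv])
  rw [← mul_genB_right_comm] at k1
  rw [← mul_genB_inv_right_comm] at k2
  -- Two blockers in the same direction would be adjacent members of one neighbouring triangle.
  have h01 : j0 ≠ j1 := by
    rintro rfl
    exact k0.not_mul hω genB_mem k1
  have h02 : j0 ≠ j2 := by
    rintro rfl
    exact k0.not_mul hω genB_inv_mem k2
  have h12 : j1 ≠ j2 := by
    rintro rfl
    refine k1.not_mul hω genB_mem ?_
    rwa [mul_assoc, genB_mul_genB]
  -- Three distinct elements of `Fin 3` cannot all differ from `i`.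
  omega

open Classical in
/-- The colour of `x` is the position of `x` in its triangle relative to the greedy set. -/
def greedyColoring (ω : Gam → unitInterval) (x : Gam) : Fin 3 :=
  if InTransversal ω x then 0 else if InTransversal ω (x * genB⁻¹) then 1 else 2

lemma greedyColoring_shift (ω : Gam → unitInterval) (g : Gam) :
    greedyColoring (shift g ω) = shift g (greedyColoring ω) := by
  funext x
  simp only [greedyColoring, shift]
  congr 1
  · exact propext (inTransversal_shift ω g x)
  · congr 1
    rw [mul_assoc]
    exact propext (inTransversal_shift ω g _)

lemma measurable_greedyColoring : Measurable greedyColoring := by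
  have h : ∀ x, MeasurableSet {ω | InTransversal ω x} := fun x =>
    measurableSet_setOfPred.2 (measurable_selected measurable_key x)
  exact measurable_pi_lambda _ fun x =>
    Measurable.ite (h x) measurable_const (Measurable.ite (h _) measurable_const measurable_const)

lemma greedyColoring_ne (hω : Function.Injective ω)
    (hb : ∀ x, BddAbove {n | OnPath genA n (triMin ω) x}) {s : Gam} (hs : s ∈ gens) (x : Gam) :
    greedyColoring ω x ≠ greedyColoring ω (x * s) := by
  have hstep : ∀ y, greedyColoring ω y ≠ greedyColoring ω (y * genB) := fun y => by
    have h1 := exists_inTransversal hω hb y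
    have h2 : InTransversal ω y → ¬ InTransversal ω (y * genB) := (·.not_mul hω genB_mem)
    have h3 : InTransversal ω y → ¬ InTransversal ω (y * genB⁻¹) :=
      (·.not_mul hω genB_inv_mem)
    have h4 : InTransversal ω (y * genB) → ¬ InTransversal ω (y * genB⁻¹) := fun h => by
      have := h.not_mul hω genB_mem
      rwa [mul_assoc, genB_mul_genB] at this
    simp only [greedyColoring, mul_inv_cancel_right]
    split_ifs <;> simp_all
  rcases mem_gens.1 hs with ⟨i, rfl⟩ | rfl | rfl
  -- Across an `aᵢ`-edge, equal colours put the chosen points of both triangles at matching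
  -- positions, which are joined by `aᵢ`.
  · have hA : ∀ y, InTransversal ω y → ¬ InTransversal ω (y * genA i) :=
      fun y hy => hy.not_mul hω hs
    have h1 := exists_inTransversal hω hb x
    have h2 := exists_inTransversal hω hb (x * genA i)
    have h3 := hA x
    have h4 := hA (x * genB)
    have h5 := hA (x * genB⁻¹)
    rw [mul_genB_right_comm, mul_genB_inv_right_comm] at h2
    rw [greedyColoring, greedyColoring, mul_genB_inv_right_comm x (genA i)]
    split_ifs <;> tauto
  · exact hstep x
  · have := (hstep (x * genB⁻¹)).symm
    rwa [inv_mul_cancel_right] at this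

end Coloring

end FactorOfIID

end

/-! ### The law of the greedy colouring -/

theorem mainTheorem5 :
    FactorOfIID.AdmitsFIIDColoring FactorOfIID.Gam FactorOfIID.gens 3 := by
  open FactorOfIID in
  have hprob : IsProbabilityMeasure ((iidUniform Gam).map greedyColoring) :=
    Measure.isProbabilityMeasure_map measurable_greedyColoring.aemeasurable
  refine ⟨(iidUniform Gam).map greedyColoring, ⟨hprob, ?_⟩,
    isShiftInvariant_map isShiftInvariant_iidUniform measurable_greedyColoring
      greedyColoring_shift, greedyColoring, ⟨⟨measurable_greedyColoring, rfl⟩,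
      Filter.Eventually.of_forall fun ω g => greedyColoring_shift ω g⟩⟩
  -- Properness is a countable conjunction of measurable conditions, so it can be checked before
  -- pushing forward.
  refine (ae_map_iff measurable_greedyColoring.aemeasurable (measurableSet_setOfPred.2 ?_)).2 ?_
  · refine Measurable.forall fun x => Measurable.forall fun y => measurable_const.imp ?_
    exact measurableSet_setOfPred.1
      (measurableSet_eq_fun (measurable_pi_apply x) (measurable_pi_apply y)).compl
  filter_upwards [ae_injective_iidUniform, ae_bddAbove_onPath_triMin] with ω hω hb x y hxy
  obtain ⟨-, s, hs, h | h⟩ := (SimpleGraph.mulCayley_adj' _ _ _).1 hxy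
  · rw [← h]
    exact greedyColoring_ne hω hb hs x
  · rw [h]
    exact (greedyColoring_ne hω hb hs y).symm
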